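/- **Model.** A randomized streaming algorithm using $S$ bits of space and $r$ random bits consists of maps $\mathrm{init}:\{0,1\}^r\to\{0,1\}^S$, $\mathrm{process}:\{0,1\}^S\times U\times\{0,1\}^r\to\{0,1\}^S$ and $\mathrm{query}:\{0,1\}^S\times\{0,1\}^r\to Z$, where $U$ is the set of tokens and $Z$ the set of outputs; the random string $R\in\{0,1\}^r$ is uniform. Here $U$ is the set of edges of the complete graph on $n$ vertices and $Z$ is the set of vertex colorings. An adaptive adversary is a function $\mathrm{next}:Z^*\to U$. With $w_0=\mathrm{init}(R)$, $z_i=\mathrm{query}(w_i,R)$, $x_{i+1}=\mathrm{next}(z_0,\dots,z_i)$ and $w_{i+1}=\mathrm{process}(w_i,x_{i+1},R)$, let $G_i$ be the graph with edges $x_1,\dots,x_i$ and $\Delta(G_i)$ its maximum degree. For $f:\mathbb N\to\mathbb R$, a *robust $f(\Delta)$-coloring algorithm for $n$-vertex graphs of maximum degree up to $L$* is an algorithm such that, for every adversary, with probability at least $1/4$ over $R$ (that is, failure probability at most $3/4$), the following holds for every $1\le i\le\binom n2$ for which $x_1,\dots,x_i$ are distinct and $\Delta(G_i)\le L$: the output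 $z_i$ is a proper coloring of $G_i$ that uses at most $f(\Delta(G_i))$ colors. **Corollary.** Let $c_0>0$. Throughout, $n\ge 2$ and $L\ge 0$ are integers with $L\ge c_0\ln n$, $f:\mathbb N\to\mathbb R$ is monotone increasing with $f(L)\le n/2$, and $\mathcal A$ is a robust $f(\Delta)$-coloring algorithm for $n$-vertex graphs of maximum degree up to $L$, using $S$ bits of space and any finite number of random bits. The constants $c$ below never depend on $n$, $L$, $f$ or $\mathcal A$. 1. There is $c>0$, depending only on $c_0$, such that $S\ge c\,nL^2/f(L)$. 2. There is $c>0$, depending only on $c_0$, such that $S\ge c\,nL$ if $f(\Delta)=\Delta+1$. More generally, for every $C>0$ there is $c>0$, depending only on $c_0$ and $C$, such that $S\ge c\,nL$ whenever $f(L)\le C L$. 3. For all $B>0$ and every integer $k\ge 0$ there is $c>0$, depending only on $c_0,B,k$, such that if $S\le B\,n(\ln n)^k$, then $f(\Delta)\ge c\,\Delta^2/(\ln n)^k$ for every integer $\Delta$ with $c_0\ln n\le\Delta\le L$. 4. For every $a>0$ there is $c>0$, depending only on $c_0$ and $a$, such that $S\ge c\,L^2$ whenever $f(L)\ge a\,n$.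 -/

import Mathlib

/-- A randomized streaming algorithm over the token universe `U` with output domain `Z`, running in
`s` bits of space and using `r` random bits. -/
structure StreamAlg (U Z : Type) (s r : ℕ) where
  /-- the initial state, as a function of the random string -/
  init : (Fin r → Bool) → (Fin s → Bool)
  /-- the state update on reading one token -/
  update : (Fin s → Bool) → U → (Fin r → Bool) → (Fin s → Bool)
  /-- the output that is reported in a given state -/
  query : (Fin s → Bool) → (Fin r → Bool) → Z

namespace StreamAlg

variable {U Z : Type} {s r : ℕ}

/-- The state of the algorithm after it has read the stream `σ` (first token first), on the random
string `R`. -/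
def state (A : StreamAlg U Z s r) (R : Fin r → Bool) (σ : List U) : Fin s → Bool :=
  σ.foldl (fun w x => A.update w x R) (A.init R)

/-- The output of the algorithm when it is queried after the stream `σ`. -/
def output (A : StreamAlg U Z s r) (R : Fin r → Bool) (σ : List U) : Z :=
  A.query (A.state R σ) R

/-- The game against the adaptive adversary given by the next-token function `next`: after `i`
rounds, the stream `x₁, …, xᵢ` of tokens chosen so far, together with the list `z₀, …, zᵢ` of all
outputs seen so far, where `xᵢ = next [z₀, …, zᵢ₋₁]`. -/
def play (A : StreamAlg U Z s r) (next : List Z → U) (R : Fin r → Bool) : ℕ → List U × List Z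
  | 0 => ([], [A.output R []])
  | i + 1 =>
    let p := A.play next R i
    let σ := p.1 ++ [next p.2]
    (σ, p.2 ++ [A.output R σ])

/-- The stream `x₁, …, xᵢ` that the adversary `next` has produced after `i` rounds. -/
def advStream (A : StreamAlg U Z s r) (next : List Z → U) (R : Fin r → Bool) (i : ℕ) : List U :=
  (A.play next R i).1

/-- The probability of an event over a uniformly random string of `r` bits. -/
noncomputable def coinProb (E : (Fin r → Bool) → Prop) : ℝ :=
  (Nat.card {R : Fin r → Bool // E R} : ℝ) / 2 ^ r

/-- The algorithm is `δ`-error adversarially robust for the streaming problem `rel` on streams of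
length at most `m`: against each adaptive adversary, with probability at least `1 - δ` all the
outputs `z₁, …, zₘ` are correct. -/
def IsRobust (A : StreamAlg U Z s r) (rel : List U → Z → Prop) (m : ℕ) (δ : ℝ) : Prop :=
  ∀ next : List Z → U,
    1 - δ ≤ coinProb (fun R : Fin r → Bool => ∀ i, 1 ≤ i → i ≤ m →
      rel (A.advStream next R i) (A.output R (A.advStream next R i)))

end StreamAlg

/-- A token of an insert-only graph stream on `n` vertices: an edge of the complete graph. -/
abbrev EdgeToken (n : ℕ) : Type := {e : Sym2 (Fin n) // ¬ e.IsDiag}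

/-- The graph that consists of the edges listed by the stream. -/
def streamGraph {n : ℕ} (σ : List (EdgeToken n)) : SimpleGraph (Fin n) :=
  SimpleGraph.fromEdgeSet {e | ∃ x ∈ σ, x.1 = e}

open Classical in
/-- The maximum degree of the graph described by the stream. -/
noncomputable def streamMaxDegree {n : ℕ} (σ : List (EdgeToken n)) : ℕ :=
  (streamGraph σ).maxDegree

/-- The coloring problem for insert-only streams of `n`-vertex graphs: as long as the stream lists
each edge at most once and its graph has maximum degree at most `L`, a valid output is a proper
coloring of the current graph that uses at most `f Δ` colors, with `Δ` the current maximum degree.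
Nothing is required of the output when the stream violates the promise. -/
def ColoringProblem (n L : ℕ) (f : ℕ → ℝ) (σ : List (EdgeToken n)) (χ : Fin n → ℕ) : Prop :=
  σ.Nodup → streamMaxDegree σ ≤ L →
    (∀ u v, (streamGraph σ).Adj u v → χ u ≠ χ v) ∧
      ((Finset.univ.image χ).card : ℝ) ≤ f (streamMaxDegree σ)

/-- The algorithm maintains, on graphs of maximum degree up to `L`, a coloring with at most `f Δ`
colors, and has total failure probability at most `δ` against each adaptive adversary. The length
bound `n.choose 2` covers every insert-only stream of a simple graph on `n` vertices. -/
def IsRobustColoring {n s r : ℕ} (A : StreamAlg (EdgeToken n) (Fin n → ℕ) s r)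
    (L : ℕ) (f : ℕ → ℝ) (δ : ℝ) : Prop :=
  A.IsRobust (ColoringProblem n L f) (n.choose 2) δ

/-!
A robust coloring algorithm leaks information about its input through its outputs: every pair of
vertices of the same color is known to be a non-edge. The lower bound turns this into a counting
argument.

Put `K = ⌊f L⌋` and divide the vertices into blocks of `2 * K` vertices. Alice holds a random graph
inside the blocks, in which each pair is an edge with probability `1 / q`, where `q` is of order
`K / L`. A union bound (`card_exists_le_card_le`) shows that its maximum degree is about `L / 2` or
less with probability at least `1 / 2`; this is where `L ≥ c₀ * log n` is used. The adversary first
inserts Alice's graph. From then on it plays greedily (`greedyPick`): it looks at the current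
coloring and inserts a monochromatic pair of some block, so long as both endpoints have received
fewer than `d = L / 2` of these later edges. If a block has more than `K` vertices of degree below
`d`, two of them share a color, so the adversary can insert about `n * L` edges, up to a constant
factor (`exists_available`). If the algorithm is always correct, none of them is an edge of Alice
(`follow_greedyPick_spec`).

The greedy phase is determined by the random string and the state of the algorithm after Alice's
stream (`StreamAlg.play_prefixAdversary`). For a fixed random string there are at most `2 ^ s` such
phases, and a fixed set of `M` pairs avoids Alice's graph with probability `(1 - 1 / q) ^ M`. As the
algorithm succeeds with probability at least `1 / 4`, it follows that
`1 / 8 ≤ 2 ^ s * (1 - 1 / q) ^ M` (`IsRobustColoring.one_eighth_le`). With `M` of order `n * L` this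
gives `s + 3 ≥ M / q`, which is of order `n * L ^ 2 / K`. The additive constant is absorbed because
`s ≥ 1` (`IsRobustColoring.one_le_space`). The other parts of the theorem follow by substituting
bounds on `f L`, and for the bound on `f Δ` by applying the main bound with `Δ` in place of `L`.
-/

/-! ### The adversary that extends a fixed stream -/

namespace StreamAlg

/-- The replies of a player who, on seeing the outputs `zs` one by one, answers each output `z` with
the token `pick b z`, where `b` lists the player's own earlier replies. -/
def replies {U Z : Type} (pick : List U → Z → U) (zs : List Z) : List U :=
  zs.foldl (fun b z => b ++ [pick b z]) []

/-- The adversary that first plays the fixed stream `σ`, whatever the outputs are, and from then on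
answers according to `pick`. The token `u₀` is a default value that is never played. -/
def prefixAdversary {U Z : Type} (u₀ : U) (σ : List U) (pick : List U → Z → U) (zs : List Z) : U :=
  (σ ++ replies pick (zs.drop σ.length)).getD (zs.length - 1) u₀

/-- The first `j` tokens that a player following `pick` inserts when the algorithm is in state `w`
at the beginning. They depend on the earlier stream only through `w`. -/
def follow {U Z : Type} {s r : ℕ} (A : StreamAlg U Z s r) (pick : List U → Z → U)
    (R : Fin r → Bool) (w : Fin s → Bool) : ℕ → List U
  | 0 => []
  | j + 1 =>
    let b := A.follow pick R w j
    b ++ [pick b (A.query (b.foldl (fun w x => A.update w x R) w) R)]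

variable {U Z : Type} {s r : ℕ}

lemma replies_concat (pick : List U → Z → U) (zs : List Z) (z : Z) :
    replies pick (zs ++ [z]) = replies pick zs ++ [pick (replies pick zs) z] := by
  simp [replies]

lemma length_follow (A : StreamAlg U Z s r) (pick : List U → Z → U) (R : Fin r → Bool)
    (w : Fin s → Bool) (j : ℕ) : (A.follow pick R w j).length = j := by
  induction j with
  | zero => rfl
  | succ j ih => simp [follow, ih]

lemma output_append (A : StreamAlg U Z s r) (R : Fin r → Bool) (σ τ : List U) :
    A.output R (σ ++ τ) =
      A.query (τ.foldl (fun w x => A.update w x R) (A.state R σ)) R := by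
  simp [output, state]

lemma follow_succ (A : StreamAlg U Z s r) (pick : List U → Z → U) (R : Fin r → Bool)
    (σ : List U) (j : ℕ) :
    A.follow pick R (A.state R σ) (j + 1) = A.follow pick R (A.state R σ) j ++
      [pick (A.follow pick R (A.state R σ) j)
        (A.output R (σ ++ A.follow pick R (A.state R σ) j))] := by
  rw [output_append]; rfl

lemma exists_play_snd (A : StreamAlg U Z s r) (next : List Z → U) (R : Fin r → Bool) (i : ℕ) :
    ∃ l : List Z, l.length = i ∧
      (A.play next R i).2 = l ++ [A.output R (A.play next R i).1] := by
  induction i with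
  | zero => exact ⟨[], rfl, rfl⟩
  | succ i ih =>
    obtain ⟨l, hl, h⟩ := ih
    exact ⟨(A.play next R i).2, by rw [h]; simp [hl], rfl⟩

lemma play_prefixAdversary_fst (A : StreamAlg U Z s r) (u₀ : U) (σ : List U)
    (pick : List U → Z → U) (R : Fin r → Bool) (i : ℕ) (hi : i ≤ σ.length) :
    (A.play (prefixAdversary u₀ σ pick) R i).1 = σ.take i := by
  induction i with
  | zero => simp [play]
  | succ i ih =>
    obtain ⟨l, hl, h⟩ := A.exists_play_snd (prefixAdversary u₀ σ pick) R i
    have hi' : i < σ.length := hi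
    simp only [play, ih hi'.le]
    rw [h, prefixAdversary]
    rw [List.take_add_one, List.length_append, hl]
    simp [hi', List.getElem?_append, List.getD]

/-- After the prefix `σ` the game continues with the tokens of `StreamAlg.follow`, which depend on
`σ` only through the state it leads to. The second conjunct is the induction hypothesis that the
adversary reconstructs its own earlier tokens from the outputs. -/
lemma play_prefixAdversary (A : StreamAlg U Z s r) (u₀ : U) (σ : List U)
    (pick : List U → Z → U) (R : Fin r → Bool) (j : ℕ) :
    (A.play (prefixAdversary u₀ σ pick) R (σ.length + j)).1 =
        σ ++ A.follow pick R (A.state R σ) j ∧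
      replies pick ((A.play (prefixAdversary u₀ σ pick) R (σ.length + j)).2.drop σ.length) =
        A.follow pick R (A.state R σ) (j + 1) := by
  induction j with
  | zero =>
    obtain ⟨l, hl, h⟩ := A.exists_play_snd (prefixAdversary u₀ σ pick) R σ.length
    have h1 : (A.play (prefixAdversary u₀ σ pick) R σ.length).1 = σ := by
      rw [A.play_prefixAdversary_fst _ _ _ _ _ le_rfl, List.take_length]
    refine ⟨by simpa [follow] using h1, ?_⟩
    rw [add_zero, h, h1, ← hl, List.drop_left]
    simp [replies, follow, output]
  | succ j ih =>
    obtain ⟨ih1, ih2⟩ := ih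
    obtain ⟨l, hl, h⟩ := A.exists_play_snd (prefixAdversary u₀ σ pick) R (σ.length + j)
    have hlen : (A.play (prefixAdversary u₀ σ pick) R (σ.length + j)).2.length =
        σ.length + j + 1 := by rw [h]; simp [hl]
    have h1 : (A.play (prefixAdversary u₀ σ pick) R (σ.length + (j + 1))).1 =
        σ ++ A.follow pick R (A.state R σ) (j + 1) := by
      have hnext : prefixAdversary u₀ σ pick
          (A.play (prefixAdversary u₀ σ pick) R (σ.length + j)).2 =
          pick (A.follow pick R (A.state R σ) j)
            (A.output R (σ ++ A.follow pick R (A.state R σ) j)) := by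
        conv_lhs => rw [prefixAdversary]
        rw [ih2, follow_succ, hlen]
        simp [List.getD, length_follow]
      rw [← add_assoc]
      simp only [play]
      rw [hnext, ih1, follow_succ, List.append_assoc]
    refine ⟨h1, ?_⟩
    have h2 : (A.play (prefixAdversary u₀ σ pick) R (σ.length + (j + 1))).2 =
        (A.play (prefixAdversary u₀ σ pick) R (σ.length + j)).2 ++
          [A.output R (A.play (prefixAdversary u₀ σ pick) R (σ.length + (j + 1))).1] := rfl
    rw [h2, List.drop_append_of_le_length (by omega), replies_concat, ih2, h1,
      follow_succ _ _ _ _ (j + 1)]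

/-- Robustness against `prefixAdversary`: with the promised probability, the outputs are correct
on every continuation of `σ` by the tokens that follow `pick`. -/
lemma IsRobust.le_coinProb_follow {A : StreamAlg U Z s r} {rel : List U → Z → Prop} {m : ℕ}
    {δ : ℝ} (h : A.IsRobust rel m δ) (u₀ : U) (σ : List U) (pick : List U → Z → U) :
    1 - δ ≤ coinProb (fun R : Fin r → Bool => ∀ j, 1 ≤ σ.length + j → σ.length + j ≤ m →
      rel (σ ++ A.follow pick R (A.state R σ) j)
        (A.output R (σ ++ A.follow pick R (A.state R σ) j))) := by
  refine (h (prefixAdversary u₀ σ pick)).trans ?_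
  unfold coinProb
  gcongr
  refine Nat.card_le_card_of_injective (Subtype.map id fun R hR j h1 h2 => ?_)
    (Subtype.map_injective _ Function.injective_id)
  have := hR _ h1 h2
  rwa [advStream, (A.play_prefixAdversary u₀ σ pick R j).1] at this

lemma exists_of_coinProb_pos {E : (Fin r → Bool) → Prop} (h : 0 < coinProb E) : ∃ R, E R := by
  by_contra! hE
  have : IsEmpty {R // E R} := ⟨fun R => hE _ R.2⟩
  simp [coinProb] at h

end StreamAlg

/-! ### Degrees and the greedy player -/

section Graphs

variable {n : ℕ}

/-- The number of tokens of the stream that are incident with the vertex `v`, counted with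
multiplicity. -/
def tokenDegree (σ : List (EdgeToken n)) (v : Fin n) : ℕ :=
  σ.countP (fun e => decide (v ∈ e.1))

lemma tokenDegree_append (σ τ : List (EdgeToken n)) (v : Fin n) :
    tokenDegree (σ ++ τ) v = tokenDegree σ v + tokenDegree τ v :=
  List.countP_append

lemma tokenDegree_singleton_le (e : EdgeToken n) (v : Fin n) : tokenDegree [e] v ≤ 1 :=
  List.countP_le_length

lemma sum_tokenDegree_le (σ : List (EdgeToken n)) : ∑ v, tokenDegree σ v ≤ 2 * σ.length := by
  induction σ with
  | nil => simp [tokenDegree]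
  | cons e σ ih =>
    have h1 : ∀ v, tokenDegree (e :: σ) v = tokenDegree σ v + if v ∈ e.1 then 1 else 0 := by
      intro v
      simp [tokenDegree, List.countP_cons]
    have h2 : (Finset.univ.filter (fun v => v ∈ e.1)).card ≤ 2 := by
      obtain ⟨e, he⟩ := e
      induction e with
      | _ a b =>
        refine (Finset.card_le_card (t := {a, b}) ?_).trans Finset.card_le_two
        intro v
        simp
    simp only [h1, Finset.sum_add_distrib, Finset.sum_boole, List.length_cons]
    push_cast
    omega

lemma streamMaxDegree_le {σ : List (EdgeToken n)} {D : ℕ} (h : ∀ v, tokenDegree σ v ≤ D) :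
    streamMaxDegree σ ≤ D := by
  classical
  unfold streamMaxDegree
  refine SimpleGraph.maxDegree_le_of_forall_degree_le _ _ fun v => le_trans ?_ (h v)
  have hinj : Function.Injective (fun u : Fin n => s(v, u)) := fun u u' huu =>
    Sym2.congr_right.1 huu
  rw [← SimpleGraph.card_neighborFinset_eq_degree, ← Finset.card_image_of_injective _ hinj]
  have hsub : ((streamGraph σ).neighborFinset v).image (fun u => s(v, u)) ⊆
      ((σ.filter (fun e => decide (v ∈ e.1))).map Subtype.val).toFinset := by
    intro e he
    obtain ⟨u, hu, rfl⟩ := Finset.mem_image.1 he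
    rw [SimpleGraph.mem_neighborFinset, streamGraph, SimpleGraph.fromEdgeSet_adj] at hu
    obtain ⟨⟨x, hx, hxe⟩, -⟩ := hu
    simp only [List.mem_toFinset, List.mem_map, List.mem_filter, decide_eq_true_eq]
    exact ⟨x, ⟨hx, by simp [hxe]⟩, hxe⟩
  refine (Finset.card_le_card hsub).trans ((List.toFinset_card_le _).trans ?_)
  rw [List.length_map, tokenDegree, List.countP_eq_length_filter]

lemma streamGraph_adj_of_mem {σ : List (EdgeToken n)} {u v : Fin n} {h : ¬ s(u, v).IsDiag}
    (he : (⟨s(u, v), h⟩ : EdgeToken n) ∈ σ) : (streamGraph σ).Adj u v := by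
  rw [streamGraph, SimpleGraph.fromEdgeSet_adj]
  exact ⟨⟨_, he, rfl⟩, by simpa using h⟩

lemma length_le_choose_of_nodup {σ : List (EdgeToken n)} (h : σ.Nodup) :
    σ.length ≤ n.choose 2 := by
  have := h.length_le_card
  rwa [Sym2.card_subtype_not_diag, Fintype.card_fin] at this

/-- Both endpoints of the token lie in the same block, where `blk` sends a vertex to the index of
its block and only the blocks with index below `N` count. -/
def InBlock (blk : Fin n → ℕ) (N : ℕ) (e : EdgeToken n) : Prop :=
  ∃ c < N, ∀ v ∈ e.1, blk v = c

/-- The token can be inserted by the greedy player: it lies in a block, the coloring `χ` does not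
distinguish its endpoints, and neither endpoint has reached degree `d` in the player's own
stream `τ`. -/
def Available (blk : Fin n → ℕ) (N d : ℕ) (τ : List (EdgeToken n)) (χ : Fin n → ℕ)
    (e : EdgeToken n) : Prop :=
  InBlock blk N e ∧ (∀ v ∈ e.1, tokenDegree τ v < d) ∧ ∀ u ∈ e.1, ∀ v ∈ e.1, χ u = χ v

open Classical in
/-- The greedy player inserts an available token whenever there is one. -/
noncomputable def greedyPick (blk : Fin n → ℕ) (N d : ℕ) (u₀ : EdgeToken n)
    (τ : List (EdgeToken n)) (χ : Fin n → ℕ) : EdgeToken n :=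
  if h : ∃ e, Available blk N d τ χ e then h.choose else u₀

lemma available_greedyPick {blk : Fin n → ℕ} {N d : ℕ} {τ : List (EdgeToken n)} {χ : Fin n → ℕ}
    (u₀ : EdgeToken n) (h : ∃ e, Available blk N d τ χ e) :
    Available blk N d τ χ (greedyPick blk N d u₀ τ χ) := by
  rw [greedyPick, dif_pos h]
  exact h.choose_spec

/-- As long as the greedy player has inserted fewer than `N * K * d / 2` tokens, some block of
`2 * K` vertices has more than `K` vertices of degree below `d`, and two of them share one of the
`K` colors. -/
lemma exists_available {blk : Fin n → ℕ} {N K d : ℕ} {τ : List (EdgeToken n)} {χ : Fin n → ℕ}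
    (hblk : ∀ c < N, (Finset.univ.filter (fun v => blk v = c)).card = 2 * K)
    (hχ : (Finset.univ.image χ).card ≤ K) (hτ : 2 * τ.length < N * K * d) :
    ∃ e, Available blk N d τ χ e := by
  by_contra hno
  have hblock : ∀ c < N, K * d ≤ ∑ v with blk v = c, tokenDegree τ v := by
    intro c hc
    set U := Finset.univ.filter (fun v => blk v = c)
    have hinj : Set.InjOn χ (U.filter (fun v => tokenDegree τ v < d)) := by
      intro u hu v hv huv
      by_contra hne
      simp only [U, Finset.coe_filter, Finset.mem_filter, Finset.mem_univ, true_and,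
        Set.mem_ofPred_eq] at hu hv
      refine hno ⟨⟨s(u, v), by simpa using hne⟩, ⟨c, hc, ?_⟩, ?_, ?_⟩
      · simp [hu.1, hv.1]
      · simp [hu.2, hv.2]
      · simp [huv]
    have hle : (U.filter (fun v => tokenDegree τ v < d)).card ≤ K := by
      rw [← Finset.card_image_of_injOn hinj]
      exact (Finset.card_le_card (Finset.image_subset_image (Finset.subset_univ _))).trans hχ
    have hsplit := Finset.card_filter_add_card_filter_not (s := U) (fun v => tokenDegree τ v < d)
    have hU : U.card = 2 * K := hblk c hc
    have hge : K ≤ (U.filter (fun v => ¬ tokenDegree τ v < d)).card := by omega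
    calc K * d ≤ (U.filter (fun v => ¬ tokenDegree τ v < d)).card * d := by gcongr
      _ ≤ ∑ v ∈ U.filter (fun v => ¬ tokenDegree τ v < d), tokenDegree τ v := by
          rw [← smul_eq_mul]
          refine Finset.card_nsmul_le_sum _ _ _ fun v hv => ?_
          simpa using (Finset.mem_filter.1 hv).2
      _ ≤ ∑ v ∈ U, tokenDegree τ v :=
          Finset.sum_le_sum_of_subset (Finset.filter_subset _ _)
  have hsum : N * (K * d) ≤ ∑ v, tokenDegree τ v := by
    calc N * (K * d) = ∑ _c ∈ Finset.range N, K * d := by simp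
      _ ≤ ∑ c ∈ Finset.range N, ∑ v with blk v = c, tokenDegree τ v :=
          Finset.sum_le_sum fun c hc => hblock c (Finset.mem_range.1 hc)
      _ ≤ ∑ v, tokenDegree τ v :=
          Finset.sum_fiberwise_le_sum_of_sum_fiber_nonneg (by simp)
  have := sum_tokenDegree_le τ
  rw [mul_assoc] at hτ
  omega

/-- The greedy player's stream against an algorithm that is correct throughout: its tokens are
new, lie in blocks, and give no vertex a degree above `d`. -/
lemma follow_greedyPick_spec {s r L N K d : ℕ} {f : ℕ → ℝ}
    {A : StreamAlg (EdgeToken n) (Fin n → ℕ) s r} {R : Fin r → Bool} {blk : Fin n → ℕ}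
    {σ : List (EdgeToken n)} (u₀ : EdgeToken n) (hf : Monotone f) (hfL : f L < K + 1)
    (hblk : ∀ c < N, (Finset.univ.filter (fun v => blk v = c)).card = 2 * K)
    (hσ : σ.Nodup) (hσ0 : σ ≠ []) (hσd : ∀ v, tokenDegree σ v + d ≤ L)
    (hR : ∀ j, 1 ≤ σ.length + j → σ.length + j ≤ n.choose 2 → ColoringProblem n L f
      (σ ++ A.follow (greedyPick blk N d u₀) R (A.state R σ) j)
      (A.output R (σ ++ A.follow (greedyPick blk N d u₀) R (A.state R σ) j)))
    (j : ℕ) (hj : 2 * j ≤ N * K * d + 1) :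
    (σ ++ A.follow (greedyPick blk N d u₀) R (A.state R σ) j).Nodup ∧
      (∀ e ∈ A.follow (greedyPick blk N d u₀) R (A.state R σ) j, InBlock blk N e) ∧
      ∀ v, tokenDegree (A.follow (greedyPick blk N d u₀) R (A.state R σ) j) v ≤ d := by
  induction j with
  | zero => simpa [StreamAlg.follow, tokenDegree] using hσ
  | succ j ih =>
    obtain ⟨hnd, hin, hdeg⟩ := ih (by omega)
    rw [StreamAlg.follow_succ]
    have hlen := A.length_follow (greedyPick blk N d u₀) R (A.state R σ) j
    have hcol := hR j (by have := List.length_pos_iff.2 hσ0; omega)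
      (by simpa [hlen] using length_le_choose_of_nodup hnd)
    set τ := A.follow (greedyPick blk N d u₀) R (A.state R σ) j with hτ
    set χ := A.output R (σ ++ τ)
    have hΔ : streamMaxDegree (σ ++ τ) ≤ L := streamMaxDegree_le fun v => by
      rw [tokenDegree_append]
      exact (Nat.add_le_add_left (hdeg v) _).trans (hσd v)
    obtain ⟨hproper, hcard⟩ := hcol hnd hΔ
    have hχ : (Finset.univ.image χ).card ≤ K := by
      have h : ((Finset.univ.image χ).card : ℝ) < K + 1 := (hcard.trans (hf hΔ)).trans_lt hfL
      exact Nat.lt_succ_iff.1 (by exact_mod_cast h)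
    obtain ⟨hblock, hlt, hmono⟩ :=
      available_greedyPick u₀ (exists_available (d := d) (τ := τ) hblk hχ (by omega))
    set e := greedyPick blk N d u₀ τ χ
    have hnew : e ∉ σ ++ τ := by
      intro hmem
      obtain ⟨p, hp⟩ := e
      induction p with
      | _ u v => exact hproper u v (streamGraph_adj_of_mem hmem) (hmono u (by simp) v (by simp))
    refine ⟨?_, ?_, fun v => ?_⟩
    · rw [← List.append_assoc, List.nodup_append]
      refine ⟨hnd, by simp, ?_⟩
      intro a ha b hb hab
      simp only [List.mem_singleton] at hb
      exact hnew (hb ▸ hab ▸ ha)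
    · intro x hx
      rcases List.mem_append.1 hx with hx | hx
      · exact hin x hx
      · rw [List.mem_singleton.1 hx]; exact hblock
    · rw [tokenDegree_append]
      by_cases hv : v ∈ e.1
      · have := tokenDegree_singleton_le e v
        have := hlt v hv
        omega
      · have : tokenDegree [e] v = 0 := by simp [tokenDegree, hv]
        have := hdeg v
        omega

end Graphs

/-! ### Counting random token sets -/

section Counting

open Finset

lemma card_forall_mem {E : Type} [Fintype E] [DecidableEq E] {p : ℕ} (S : Finset E)
    (t : Finset (Fin (p + 1))) :
    #{ω : E → Fin (p + 1) | ∀ e ∈ S, ω e ∈ t} =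
      #t ^ #S * (p + 1) ^ (Fintype.card E - #S) := by
  have h : ({ω : E → Fin (p + 1) | ∀ e ∈ S, ω e ∈ t} : Finset _) =
      Fintype.piFinset (fun e => if e ∈ S then t else univ) := by
    ext ω
    simp only [mem_filter, mem_univ, true_and, Fintype.mem_piFinset]
    refine forall_congr' fun e => ?_
    split_ifs with he <;> simp [he]
  rw [h, Fintype.card_piFinset]
  simp only [apply_ite Finset.card, prod_ite, prod_const, card_univ, Fintype.card_fin]
  congr 2
  · simp
  · rw [← card_compl]
    congr 1
    ext e
    simp

/-- For a uniformly random `ω`, the set of `e` with `ω e = 0` contains `S` with probability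
`(p + 1) ^ (-#S)`. -/
lemma card_forall_eq_zero {E : Type} [Fintype E] [DecidableEq E] {p : ℕ} (S : Finset E) :
    (#{ω : E → Fin (p + 1) | ∀ e ∈ S, ω e = 0} : ℝ) =
      (p + 1 : ℝ) ^ Fintype.card E / (p + 1 : ℝ) ^ #S := by
  have h := card_forall_mem (p := p) S {0}
  simp only [mem_singleton, card_singleton, one_pow, one_mul] at h
  rw [h]
  push_cast
  rw [pow_sub₀ _ (by positivity) (card_le_univ S), div_eq_mul_inv]

/-- For a uniformly random `ω`, the set of `e` with `ω e = 0` avoids `S` with probability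
`(p / (p + 1)) ^ #S`. -/
lemma card_forall_ne_zero {E : Type} [Fintype E] [DecidableEq E] {p : ℕ} (S : Finset E) :
    (#{ω : E → Fin (p + 1) | ∀ e ∈ S, ω e ≠ 0} : ℝ) =
      (p + 1 : ℝ) ^ Fintype.card E * ((p : ℝ) / (p + 1)) ^ #S := by
  have h := card_forall_mem (p := p) S {0}ᶜ
  simp only [mem_compl, mem_singleton, card_compl, Fintype.card_fin, card_singleton,
    Nat.add_sub_cancel] at h
  have hq : (0 : ℝ) < p + 1 := by positivity
  rw [h]
  push_cast
  rw [pow_sub₀ _ hq.ne' (card_le_univ S), div_pow]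
  field_simp

open Classical in
/-- A union bound over vertices `v` and over `k`-element subsets of `I v`: few `ω` vanish on `k`
elements of some `I v`. -/
lemma card_exists_le_card_le {E V : Type} [Fintype E] [Fintype V] {p m k : ℕ} (I : V → Finset E)
    (hI : ∀ v, #(I v) ≤ m) :
    (#{ω : E → Fin (p + 1) | ∃ v, k ≤ #{e ∈ I v | ω e = 0}} : ℝ) ≤
      Fintype.card V * m.choose k * ((p + 1 : ℝ) ^ Fintype.card E / (p + 1 : ℝ) ^ k) := by
  have hsub : ({ω : E → Fin (p + 1) | ∃ v, k ≤ #{e ∈ I v | ω e = 0}} : Finset _) ⊆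
      (univ : Finset V).biUnion fun v => ((I v).powersetCard k).biUnion fun S =>
        {ω : E → Fin (p + 1) | ∀ e ∈ S, ω e = 0} := by
    intro ω hω
    obtain ⟨v, hv⟩ := (mem_filter.1 hω).2
    obtain ⟨S, hS, hSk⟩ := exists_subset_card_eq hv
    simp only [mem_biUnion, mem_univ, true_and, mem_powersetCard, mem_filter]
    exact ⟨v, S, ⟨hS.trans (filter_subset _ _), hSk⟩, fun e he => (mem_filter.1 (hS he)).2⟩
  calc (#{ω : E → Fin (p + 1) | ∃ v, k ≤ #{e ∈ I v | ω e = 0}} : ℝ)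
      ≤ ∑ v : V, ∑ S ∈ (I v).powersetCard k,
          (#{ω : E → Fin (p + 1) | ∀ e ∈ S, ω e = 0} : ℝ) := by
        have h1 := (card_le_card hsub).trans (card_biUnion_le.trans
          (sum_le_sum fun v _ => card_biUnion_le))
        exact_mod_cast h1
    _ = ∑ v : V, ((#(I v)).choose k) * ((p + 1 : ℝ) ^ Fintype.card E / (p + 1 : ℝ) ^ k) := by
        refine sum_congr rfl fun v _ => ?_
        rw [← card_powersetCard, ← nsmul_eq_mul, ← sum_const]
        refine sum_congr rfl fun S hS => ?_
        rw [card_forall_eq_zero, (mem_powersetCard.1 hS).2]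
    _ ≤ ∑ _v : V, (m.choose k) * ((p + 1 : ℝ) ^ Fintype.card E / (p + 1 : ℝ) ^ k) := by
        refine sum_le_sum fun v _ => ?_
        gcongr
        exact hI v
    _ = _ := by simp; ring

/-- The counting form of a one-way communication bound. On each input `ω ∈ G`, at least a quarter
of the random strings `R` lead to a message `msg ω R` that suits `ω`, while under each fixed `R` a
message suits at most `b` inputs. Hence the inputs in `G` require many messages. -/
lemma card_le_of_messages {Ω T W : Type} [Fintype Ω] [Fintype T] [Nonempty T] [Fintype W]
    (suits : Ω → T → W → Prop) (msg : Ω → T → W) (G : Finset Ω) (b : ℝ)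
    [∀ ω R w, Decidable (suits ω R w)]
    (hG : ∀ ω ∈ G, (Fintype.card T : ℝ) / 4 ≤ #{R | suits ω R (msg ω R)})
    (hb : ∀ R w, (#{ω | suits ω R w} : ℝ) ≤ b) :
    (#G : ℝ) / 4 ≤ Fintype.card W * b := by
  have hT : (0 : ℝ) < Fintype.card T := by exact_mod_cast Fintype.card_pos
  have h1 : ∀ ω : Ω, (#{R | suits ω R (msg ω R)} : ℝ) ≤
      ∑ R : T, ∑ w : W, if suits ω R w then 1 else 0 := by
    intro ω
    rw [← sum_boole]
    refine sum_le_sum fun R _ => ?_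
    exact single_le_sum (f := fun w => if suits ω R w then (1 : ℝ) else 0)
      (fun w _ => by positivity) (mem_univ (msg ω R))
  have h2 : #G * (Fintype.card T / 4 : ℝ) ≤ Fintype.card T * (Fintype.card W * b) := by
    calc #G * (Fintype.card T / 4 : ℝ) = ∑ _ω ∈ G, (Fintype.card T / 4 : ℝ) := by simp
      _ ≤ ∑ ω ∈ G, ∑ R : T, ∑ w : W, (if suits ω R w then (1 : ℝ) else 0) :=
          sum_le_sum fun ω hω => (hG ω hω).trans (h1 ω)
      _ ≤ ∑ ω, ∑ R : T, ∑ w : W, (if suits ω R w then (1 : ℝ) else 0) :=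
          sum_le_sum_of_subset_of_nonneg (subset_univ _) fun ω _ _ => by positivity
      _ = ∑ R : T, ∑ w : W, (#{ω | suits ω R w} : ℝ) := by
          rw [sum_comm]
          refine sum_congr rfl fun R _ => ?_
          rw [sum_comm]
          simp
      _ ≤ ∑ _R : T, ∑ _w : W, b := sum_le_sum fun R _ => sum_le_sum fun w _ => hb R w
      _ = _ := by simp
  refine le_of_mul_le_mul_left ?_ hT
  linarith

end Counting

/-! ### The information bound -/

section LowerBound

open Finset

variable {n : ℕ}

lemma card_filter_div_eq {m c : ℕ} (hm : 0 < m) (h : (c + 1) * m ≤ n) :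
    #{v : Fin n | (v : ℕ) / m = c} = m := by
  have h1 : ({v : Fin n | (v : ℕ) / m = c} : Finset _).map Fin.valEmbedding =
      Ico (c * m) ((c + 1) * m) := by
    ext x
    simp only [mem_map, mem_filter, mem_univ, true_and, Fin.valEmbedding_apply, mem_Ico]
    constructor
    · rintro ⟨v, hv, rfl⟩
      have := (Nat.div_eq_iff hm).1 hv
      rw [add_mul]
      omega
    · rintro ⟨h2, h3⟩
      refine ⟨⟨x, by omega⟩, (Nat.div_eq_iff hm).2 ?_, rfl⟩
      rw [add_mul] at h3
      dsimp only
      omega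
  rw [← card_map Fin.valEmbedding, h1, Nat.card_Ico, add_mul]
  omega

open Classical in
lemma card_inBlock_incident_le {blk : Fin n → ℕ} {N m : ℕ}
    (hblk : ∀ c < N, #{v | blk v = c} = m) (v : Fin n) :
    #{e : EdgeToken n | InBlock blk N e ∧ v ∈ e.1} ≤ m := by
  rw [← card_image_of_injective _ Subtype.val_injective]
  by_cases hv : blk v < N
  · rw [← hblk _ hv]
    refine le_trans (card_le_card ?_) (card_image_le (f := fun u => s(v, u)))
    intro x hx
    obtain ⟨e, he, rfl⟩ := mem_image.1 hx
    obtain ⟨⟨c, -, hc⟩, hve⟩ := (mem_filter.1 he).2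
    obtain ⟨u, hu⟩ := Sym2.mem_iff_exists.1 hve
    refine mem_image.2 ⟨u, ?_, hu.symm⟩
    simp [hc v hve, hc u (by simp [hu])]
  · rw [filter_false_of_mem]
    · simp
    · rintro e - ⟨⟨c, hcN, hc⟩, hve⟩
      exact hv (hc v hve ▸ hcN)

lemma tokenDegree_toList (S : Finset (EdgeToken n)) (v : Fin n) :
    tokenDegree S.toList v = #{e ∈ S | v ∈ e.1} := by
  rw [tokenDegree, card_def, filter_val, ← Multiset.countP_eq_card_filter, ← coe_toList,
    Multiset.coe_countP]

/-- Alice's stream: the tokens of the blocks that `ω` sends to `0`. The token `u₀` is added so that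
the stream is nonempty, since the output on the empty stream is subject to no requirement. -/
noncomputable def aliceStream {p : ℕ} (blk : Fin n → ℕ) (N : ℕ) (u₀ : EdgeToken n)
    (ω : EdgeToken n → Fin (p + 1)) : List (EdgeToken n) :=
  open Classical in (insert u₀ ({e | InBlock blk N e ∧ ω e = 0} : Finset (EdgeToken n))).toList

lemma mem_aliceStream {p : ℕ} {blk : Fin n → ℕ} {N : ℕ} {u₀ : EdgeToken n}
    {ω : EdgeToken n → Fin (p + 1)} {e : EdgeToken n} :
    e ∈ aliceStream blk N u₀ ω ↔ e = u₀ ∨ InBlock blk N e ∧ ω e = 0 := by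
  simp [aliceStream]

open Classical in
lemma tokenDegree_aliceStream_le {p : ℕ} (blk : Fin n → ℕ) (N : ℕ) (u₀ : EdgeToken n)
    (ω : EdgeToken n → Fin (p + 1)) (v : Fin n) :
    tokenDegree (aliceStream blk N u₀ ω) v ≤
      #{e ∈ ({e | InBlock blk N e ∧ v ∈ e.1} : Finset (EdgeToken n)) | ω e = 0} + 1 := by
  rw [aliceStream, tokenDegree_toList]
  refine le_trans (card_le_card ?_) (card_insert_le u₀ _)
  intro e
  simp only [mem_filter, mem_insert, mem_univ, true_and]
  tauto

lemma coinProb_eq {r : ℕ} (E : (Fin r → Bool) → Prop) [DecidablePred E] :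
    StreamAlg.coinProb E = #{R | E R} / 2 ^ r := by
  rw [StreamAlg.coinProb, Nat.card_eq_fintype_card, Fintype.card_subtype]

/-- The information bound. Alice's stream is random, with each token of a block kept with
probability `1 / (p + 1)`; by `hbad` its degrees are below `L - d` with probability at least `1 / 2`.
The greedy player, who knows only the random string and one of the `2 ^ s` states, then names `M`
tokens that Alice does not hold, which a fixed guess achieves with probability
`(p / (p + 1)) ^ M` only. -/
lemma IsRobustColoring.one_eighth_le {s r L K N d p M : ℕ} {f : ℕ → ℝ}
    {A : StreamAlg (EdgeToken n) (Fin n → ℕ) s r} (hA : IsRobustColoring A L f (3 / 4))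
    (hf : Monotone f) (hfL : f L < K + 1) {blk : Fin n → ℕ}
    (hblk : ∀ c < N, #{v | blk v = c} = 2 * K) (hd : d ≤ L) (u₀ : EdgeToken n)
    (hbad : (n : ℝ) * (2 * K).choose (L - d) / (p + 1 : ℝ) ^ (L - d) ≤ 1 / 2)
    (hM : 2 * M ≤ N * K * d + 1) :
    (1 / 8 : ℝ) ≤ 2 ^ s * ((p : ℝ) / (p + 1)) ^ M := by
  classical
  set T := Fintype.card (EdgeToken n)
  set I : Fin n → Finset (EdgeToken n) := fun v => {e | InBlock blk N e ∧ v ∈ e.1}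
  set bad : Finset (EdgeToken n → Fin (p + 1)) :=
    {ω | ∃ v, L - d ≤ #{e ∈ I v | ω e = 0}}
  have hq : (0 : ℝ) < (p + 1 : ℝ) ^ T := by positivity
  have hbad' : (#bad : ℝ) ≤ (p + 1 : ℝ) ^ T / 2 := by
    have h1 : (#bad : ℝ) ≤ n * (2 * K).choose (L - d) *
        ((p + 1 : ℝ) ^ T / (p + 1 : ℝ) ^ (L - d)) := by
      have h0 := card_exists_le_card_le (p := p) (k := L - d) I (card_inBlock_incident_le hblk)
      rw [Fintype.card_fin] at h0
      convert h0
    refine h1.trans ?_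
    calc (n : ℝ) * (2 * K).choose (L - d) * ((p + 1 : ℝ) ^ T / (p + 1 : ℝ) ^ (L - d))
        = (n : ℝ) * (2 * K).choose (L - d) / (p + 1 : ℝ) ^ (L - d) * (p + 1 : ℝ) ^ T := by ring
      _ ≤ 1 / 2 * (p + 1 : ℝ) ^ T := by gcongr
      _ = _ := by ring
  have hgood : (p + 1 : ℝ) ^ T / 2 ≤ #badᶜ := by
    have h1 : (#bad : ℝ) + #badᶜ = (p + 1 : ℝ) ^ T := by
      have := card_add_card_compl bad
      rw [Fintype.card_fun, Fintype.card_fin] at this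
      exact_mod_cast this
    linarith
  set pick := greedyPick blk N d u₀
  have hmain := card_le_of_messages
    (suits := fun (ω : EdgeToken n → Fin (p + 1)) (R : Fin r → Bool) (w : Fin s → Bool) =>
      (A.follow pick R w M).Nodup ∧ ∀ e ∈ A.follow pick R w M, ω e ≠ 0)
    (msg := fun ω R => A.state R (aliceStream blk N u₀ ω)) badᶜ
    ((p + 1 : ℝ) ^ T * ((p : ℝ) / (p + 1)) ^ M) ?_ ?_
  · simp only [Fintype.card_fun, Fintype.card_fin, Fintype.card_bool] at hmain
    push_cast at hmain
    have h2 : (p + 1 : ℝ) ^ T * (1 / 8) ≤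
        (p + 1 : ℝ) ^ T * (2 ^ s * ((p : ℝ) / (p + 1)) ^ M) := by linarith
    exact le_of_mul_le_mul_left h2 hq
  · intro ω hω
    have hdeg : ∀ v, tokenDegree (aliceStream blk N u₀ ω) v + d ≤ L := by
      intro v
      have h1 := tokenDegree_aliceStream_le blk N u₀ ω v
      have h2 : ¬ L - d ≤ #{e ∈ I v | ω e = 0} := fun h =>
        mem_compl.1 hω (mem_filter.2 ⟨mem_univ _, v, h⟩)
      simp only [I] at h2
      omega
    have hprob := StreamAlg.IsRobust.le_coinProb_follow hA u₀ (aliceStream blk N u₀ ω) pick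
    rw [coinProb_eq, le_div_iff₀ (by positivity)] at hprob
    simp only [Fintype.card_fun, Fintype.card_fin, Fintype.card_bool]
    push_cast
    refine le_trans (by linarith) (hprob.trans (Nat.cast_le.2 (card_le_card ?_)))
    intro R hR
    obtain ⟨hnd, hin, -⟩ := follow_greedyPick_spec u₀ hf hfL hblk
      (show (aliceStream blk N u₀ ω).Nodup from nodup_toList _)
      (List.ne_nil_of_mem (mem_aliceStream.2 (Or.inl rfl))) hdeg (mem_filter.1 hR).2 M hM
    rw [List.nodup_append] at hnd
    refine mem_filter.2 ⟨mem_univ _, hnd.2.1, fun e he h0 => ?_⟩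
    exact hnd.2.2 e (mem_aliceStream.2 (Or.inr ⟨hin e he, h0⟩)) e he rfl
  · intro R w
    by_cases hnd : (A.follow pick R w M).Nodup
    · have hcard : #(A.follow pick R w M).toFinset = M := by
        rw [List.toFinset_card_of_nodup hnd, A.length_follow]
      have h1 := card_forall_ne_zero (p := p) (A.follow pick R w M).toFinset
      rw [hcard] at h1
      rw [← h1]
      refine le_of_eq ?_
      congr 3
      ext ω
      simp [hnd]
    · simp only [hnd, false_and, filter_false, card_empty, Nat.cast_zero]
      positivity

/-- For some random string, the output after one insertion is correct; the inserted edge is a function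
`g` of the output on the empty stream. -/
lemma IsRobustColoring.exists_single {s r L : ℕ} {f : ℕ → ℝ}
    {A : StreamAlg (EdgeToken n) (Fin n → ℕ) s r} (hA : IsRobustColoring A L f (3 / 4))
    (hf : Monotone f) (hn : 2 ≤ n) (hL : 1 ≤ L) (g : (Fin n → ℕ) → EdgeToken n) :
    ∃ R, (∀ u v, (g (A.output R [])).1 = s(u, v) →
      A.output R [g (A.output R [])] u ≠ A.output R [g (A.output R [])] v) ∧
      (#(univ.image (A.output R [g (A.output R [])])) : ℝ) ≤ f L := by
  have hprob := StreamAlg.IsRobust.le_coinProb_follow hA (g fun _ => 0) [] (fun _ => g)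
  obtain ⟨R, hR⟩ := StreamAlg.exists_of_coinProb_pos (lt_of_lt_of_le (by norm_num) hprob)
  have hfol : A.follow (fun _ => g) R (A.state R []) 1 = [g (A.output R [])] := by
    rw [StreamAlg.follow_succ]
    simp [StreamAlg.follow]
  have h1 := hR 1 (by simp) (by simpa using Nat.succ_le_of_lt (Nat.choose_pos hn))
  rw [hfol, List.nil_append] at h1
  have hΔ : streamMaxDegree [g (A.output R [])] ≤ L :=
    streamMaxDegree_le fun v => (tokenDegree_singleton_le _ v).trans hL
  obtain ⟨hproper, hcard⟩ := h1 (List.nodup_singleton _) hΔ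
  refine ⟨R, fun u v huv => hproper u v ?_, hcard.trans (hf hΔ)⟩
  refine streamGraph_adj_of_mem (h := huv ▸ (g (A.output R [])).2) ?_
  rw [List.mem_singleton]
  exact Subtype.ext huv.symm

lemma IsRobustColoring.one_le_colors {s r L : ℕ} {f : ℕ → ℝ}
    {A : StreamAlg (EdgeToken n) (Fin n → ℕ) s r} (hA : IsRobustColoring A L f (3 / 4))
    (hf : Monotone f) (hn : 2 ≤ n) (hL : 1 ≤ L) : 1 ≤ f L := by
  let a : Fin n := ⟨0, by omega⟩
  let b : Fin n := ⟨1, by omega⟩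
  obtain ⟨R, -, hcard⟩ := hA.exists_single hf hn hL fun _ => ⟨s(a, b), by simp [a, b]⟩
  refine le_trans ?_ hcard
  exact_mod_cast card_pos.2 ⟨_, mem_image_of_mem _ (mem_univ a)⟩

/-- An algorithm without memory repeats its first output, so that the adversary can insert an edge
whose endpoints share a color. -/
lemma IsRobustColoring.one_le_space {s r L : ℕ} {f : ℕ → ℝ}
    {A : StreamAlg (EdgeToken n) (Fin n → ℕ) s r} (hA : IsRobustColoring A L f (3 / 4))
    (hf : Monotone f) (hn : 2 ≤ n) (hL : 1 ≤ L) (hfL : f L < n) : 1 ≤ s := by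
  classical
  by_contra hs
  obtain rfl : s = 0 := by omega
  let a : Fin n := ⟨0, by omega⟩
  let b : Fin n := ⟨1, by omega⟩
  let g : (Fin n → ℕ) → EdgeToken n := fun χ =>
    if h : ∃ e : EdgeToken n, ∀ u ∈ e.1, ∀ v ∈ e.1, χ u = χ v then h.choose
    else ⟨s(a, b), by simp [a, b]⟩
  obtain ⟨R, hproper, hcard⟩ := hA.exists_single hf hn hL g
  have hconst : A.output R [g (A.output R [])] = A.output R [] := by
    rw [StreamAlg.output, StreamAlg.output,
      Subsingleton.elim (A.state R [g (A.query (A.state R []) R)]) (A.state R [])]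
  rw [hconst] at hproper hcard
  generalize A.output R [] = χ at hproper hcard
  have hex : ∃ e : EdgeToken n, ∀ u ∈ e.1, ∀ v ∈ e.1, χ u = χ v := by
    have hlt : #(univ.image χ) < #(univ : Finset (Fin n)) := by
      rw [card_univ, Fintype.card_fin]
      exact_mod_cast hcard.trans_lt hfL
    obtain ⟨u, -, v, -, hne, huv⟩ := exists_ne_map_eq_of_card_lt_of_maps_to hlt
      (fun u hu => mem_image_of_mem χ hu)
    exact ⟨⟨s(u, v), by simpa using hne⟩, by simp [huv]⟩
  have hg : g χ = hex.choose := dif_pos hex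
  obtain ⟨u, v, huv⟩ : ∃ u v, (g χ).1 = s(u, v) := by
    induction (g χ).1 with
    | _ u v => exact ⟨u, v, rfl⟩
  refine hproper u v huv (hex.choose_spec u ?_ v ?_) <;> rw [← hg, huv] <;> simp

end LowerBound

/-! ### Choice of the parameters -/

section Asymptotics

lemma choose_le_mul_exp_div_pow (m k : ℕ) (hk : 0 < k) :
    (m.choose k : ℝ) ≤ (m * Real.exp 1 / k) ^ k := by
  have h1 : (m.choose k : ℝ) ≤ (m : ℝ) ^ k / k.factorial := Nat.choose_le_pow_div k m
  have h2 := Real.pow_div_factorial_le_exp (k : ℝ) (by positivity) k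
  have hk' : (0 : ℝ) < k := by exact_mod_cast hk
  have hf : (0 : ℝ) < k.factorial := by exact_mod_cast k.factorial_pos
  rw [div_le_iff₀ hf] at h2
  refine h1.trans ?_
  rw [div_pow, mul_pow, ← Real.exp_nat_mul, mul_one, div_le_div_iff₀ hf (by positivity), mul_assoc]
  gcongr

lemma le_add_three_of_one_eighth_le {s p M : ℕ}
    (h : (1 / 8 : ℝ) ≤ 2 ^ s * ((p : ℝ) / (p + 1)) ^ M) : (M : ℝ) / (p + 1) ≤ s + 3 := by
  have hle : (p : ℝ) / (p + 1) ≤ Real.exp (-(1 / (p + 1 : ℝ))) := by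
    refine le_trans (le_of_eq ?_) (Real.add_one_le_exp _)
    field_simp
    ring
  have h1 : (1 / 8 : ℝ) ≤ 2 ^ s * Real.exp (-((M : ℝ) / (p + 1))) := by
    refine h.trans (mul_le_mul_of_nonneg_left ?_ (by positivity))
    calc ((p : ℝ) / (p + 1)) ^ M ≤ Real.exp (-(1 / (p + 1 : ℝ))) ^ M := by gcongr
      _ = _ := by
        rw [← Real.exp_nat_mul]
        congr 1
        ring
  have h2 : (2 : ℝ) ≤ Real.exp 1 := by linarith [Real.add_one_le_exp (1 : ℝ)]
  rw [← Real.exp_le_exp]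
  calc Real.exp ((M : ℝ) / (p + 1)) ≤ 2 ^ (s + 3) := by
        rw [Real.exp_neg, ← div_eq_mul_inv, le_div_iff₀ (Real.exp_pos _)] at h1
        rw [pow_add]
        linarith
    _ ≤ Real.exp 1 ^ (s + 3) := by gcongr
    _ = _ := by rw [← Real.exp_nat_mul]; congr 1; push_cast; ring

/-- The main bound, with the number of colors rounded down to `K`. -/
lemma IsRobustColoring.space_ge {c₀ : ℝ} (hc₀ : 0 < c₀) {n s r L K : ℕ} {f : ℕ → ℝ}
    {A : StreamAlg (EdgeToken n) (Fin n → ℕ) s r} (hA : IsRobustColoring A L f (3 / 4))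
    (hn : 2 ≤ n) (hf : Monotone f) (hL : c₀ * Real.log n ≤ L) (hL1 : 1 ≤ L)
    (hK : 1 ≤ K) (hKn : 2 * K ≤ n) (hfL : f L < K + 1) (hs : 1 ≤ s) :
    n * (L : ℝ) ^ 2 / K ≤ 768 * Real.exp (1 + 4 / c₀) * s := by
  have hs' : (1 : ℝ) ≤ s := by exact_mod_cast hs
  have hK' : (1 : ℝ) ≤ K := by exact_mod_cast hK
  have hn0 : (0 : ℝ) < n := by positivity
  have hn2 : (2 : ℝ) ≤ n := by exact_mod_cast hn
  set X := Real.exp (1 + 4 / c₀) with hX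
  have hX1 : 1 ≤ X := Real.one_le_exp (by positivity)
  rcases Nat.lt_or_ge L 2 with hL2 | hL2
  · -- Here the logarithmic lower bound on `L` bounds `n` by a constant.
    obtain rfl : L = 1 := by omega
    have h1 : (n : ℝ) ≤ X := by
      rw [← Real.exp_log hn0]
      refine Real.exp_le_exp.2 ?_
      have h2 : Real.log n ≤ 1 / c₀ := by
        rw [le_div_iff₀ hc₀]
        push_cast at hL
        linarith
      have h3 : (4 : ℝ) / c₀ = 4 * (1 / c₀) := by ring
      have h4 : 0 < 1 / c₀ := by positivity
      linarith
    calc (n : ℝ) * ((1 : ℕ) : ℝ) ^ 2 / K ≤ n := by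
          rw [Nat.cast_one, one_pow, mul_one]
          exact div_le_self hn0.le hK'
      _ ≤ 768 * X * s := by nlinarith
  -- The greedy player may use degree `d`, Alice the remaining degree `k`.
  set d := L / 2 with hd
  set k := L - d with hk
  have hk0 : 0 < k := by omega
  have hk' : (0 : ℝ) < k := by exact_mod_cast hk0
  have hdL : (L : ℝ) ≤ 3 * d := by exact_mod_cast (show L ≤ 3 * d by omega)
  have hkL : (L : ℝ) ≤ 2 * k := by exact_mod_cast (show L ≤ 2 * k by omega)
  set N := n / (2 * K) with hN
  have hNn : N * (2 * K) ≤ n := Nat.div_mul_le_self _ _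
  have hN1 : 1 ≤ N := (Nat.one_le_div_iff (by omega)).2 hKn
  have hnN : n ≤ 4 * (N * K) := by
    have h1 : n < (N + 1) * (2 * K) := Nat.lt_mul_of_div_lt (by omega) (by omega)
    nlinarith
  have hblk : ∀ c < N, (Finset.univ.filter fun v : Fin n => (v : ℕ) / (2 * K) = c).card =
      2 * K := fun c hc => card_filter_div_eq (by omega) (by
        have : (c + 1) * (2 * K) ≤ N * (2 * K) := Nat.mul_le_mul_right _ hc
        omega)
  set M := (N * K * d + 1) / 2 with hM
  have hM2 : 2 * M ≤ N * K * d + 1 := by omega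
  have hMge : (n : ℝ) * d ≤ 8 * M := by
    have h1 : n * d ≤ 4 * (N * K * d) := by
      calc n * d ≤ 4 * (N * K) * d := Nat.mul_le_mul_right _ hnN
        _ = _ := by ring
    exact_mod_cast (show n * d ≤ 8 * M by omega)
  let u₀ : EdgeToken n := ⟨s((⟨0, by omega⟩ : Fin n), ⟨1, by omega⟩), by simp⟩
  have hkey : ∀ p : ℕ, (n : ℝ) * (2 * K).choose k / (p + 1 : ℝ) ^ k ≤ 1 / 2 →
      (1 / 8 : ℝ) ≤ 2 ^ s * ((p : ℝ) / (p + 1)) ^ M := fun p hp =>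
    hA.one_eighth_le hf hfL hblk (Nat.div_le_self _ _) u₀ hp hM2
  -- If `k > 2 * K`, Alice could hold every token of the blocks, and the greedy player could not
  -- find a single new one: this is the case `p = 0`.
  have hk2K : k ≤ 2 * K := by
    by_contra hlt
    have h1 := hkey 0 (by rw [Nat.choose_eq_zero_of_lt (by omega)]; norm_num)
    have hM0 : M ≠ 0 := by
      have : 1 ≤ N * K * d := Nat.mul_pos (Nat.mul_pos hN1 hK) (by omega)
      omega
    simp only [Nat.cast_zero, zero_div, zero_pow hM0, mul_zero] at h1
    norm_num at h1
  have hk2K' : (k : ℝ) ≤ 2 * K := by exact_mod_cast hk2K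
  -- A `k`-subset of the `2 * K` pairs at a vertex is chosen with probability `(p + 1) ^ (-k)`, and
  -- there are at most `(2 * exp 1 * K / k) ^ k` of them, so this `p` makes the expected number of
  -- chosen ones at a vertex at most `exp (-4 * k / c₀) ≤ 1 / n ^ 2`.
  set p := ⌊2 * X * K / k⌋₊ with hp
  have hp1 : 2 * X * K / k ≤ p + 1 := (Nat.lt_floor_add_one _).le
  have hp2 : (p : ℝ) + 1 ≤ 4 * X * K / k := by
    have h1 : (p : ℝ) ≤ 2 * X * K / k := Nat.floor_le (by positivity)
    have h2 : (1 : ℝ) ≤ 2 * X * K / k := by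
      rw [le_div_iff₀ hk']
      nlinarith
    have h3 : 4 * X * K / k = 2 * (2 * X * K / k) := by ring
    linarith
  have hbad : (n : ℝ) * (2 * K).choose k / (p + 1 : ℝ) ^ k ≤ 1 / 2 := by
    have h1 : ((2 * K).choose k : ℝ) ≤ (2 * K * Real.exp 1 / k) ^ k := by
      have := choose_le_mul_exp_div_pow (2 * K) k hk0
      push_cast at this
      exact this
    have h2 : (2 * K * Real.exp 1 / k) ^ k = (2 * X * K / k) ^ k * Real.exp (-(k * (4 / c₀))) := by
      rw [show -(k * (4 / c₀)) = k * (-(4 / c₀)) by ring, Real.exp_nat_mul, ← mul_pow, hX,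
        show 2 * Real.exp (1 + 4 / c₀) * K / k * Real.exp (-(4 / c₀)) =
          2 * K * (Real.exp (1 + 4 / c₀) * Real.exp (-(4 / c₀))) / k by ring, ← Real.exp_add]
      congr 4
      ring
    have h3 : Real.exp (-(k * (4 / c₀))) ≤ 1 / (n : ℝ) ^ 2 := by
      rw [one_div, Real.exp_neg]
      refine inv_anti₀ (by positivity) ?_
      rw [← Real.exp_log (show (0 : ℝ) < (n : ℝ) ^ 2 by positivity), Real.log_pow]
      refine Real.exp_le_exp.2 ?_
      rw [mul_div_assoc', le_div_iff₀ hc₀]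
      push_cast
      linarith
    rw [div_le_iff₀ (by positivity)]
    calc (n : ℝ) * (2 * K).choose k
        ≤ n * ((p + 1 : ℝ) ^ k * (1 / (n : ℝ) ^ 2)) := by
          refine mul_le_mul_of_nonneg_left (h1.trans (h2.le.trans ?_)) hn0.le
          gcongr
      _ = (1 / n) * (p + 1 : ℝ) ^ k := by field_simp
      _ ≤ 1 / 2 * (p + 1 : ℝ) ^ k := by gcongr
  have hspace := le_add_three_of_one_eighth_le (hkey p hbad)
  have h4 : (M : ℝ) / (p + 1) ≤ 4 * s := by linarith
  rw [div_le_iff₀ (by positivity)] at h4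
  rw [div_le_iff₀ (by positivity)]
  have h5 : (M : ℝ) ≤ 4 * s * (4 * X * K / k) := h4.trans (by gcongr)
  rw [mul_div_assoc', le_div_iff₀ hk'] at h5
  calc (n : ℝ) * (L : ℝ) ^ 2 = n * (L * L) := by ring
    _ ≤ n * ((3 * d) * (2 * k)) := by gcongr
    _ = 6 * (n * d) * k := by ring
    _ ≤ 6 * (8 * M) * k := by gcongr
    _ ≤ 768 * X * s * K := by linarith

/-- The main bound on the space of a robust coloring algorithm, in a form that also records that
the quantities in it are not degenerate. -/
lemma IsRobustColoring.space_bound {c₀ : ℝ} (hc₀ : 0 < c₀) {n s r L : ℕ} {f : ℕ → ℝ}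
    {A : StreamAlg (EdgeToken n) (Fin n → ℕ) s r} (hA : IsRobustColoring A L f (3 / 4))
    (hn : 2 ≤ n) (hf : Monotone f) (hL : c₀ * Real.log n ≤ L) (hfL : f L ≤ n / 2) :
    0 < (L : ℝ) ∧ 0 < f L ∧
      1 / (768 * Real.exp (1 + 4 / c₀)) * (n * (L : ℝ) ^ 2 / f L) ≤ s := by
  have hn2 : (2 : ℝ) ≤ n := by exact_mod_cast hn
  have hlog : 0 < Real.log n := Real.log_pos (by linarith)
  have hL0 : 0 < (L : ℝ) := lt_of_lt_of_le (by positivity) hL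
  have hL1 : 1 ≤ L := by exact_mod_cast hL0
  have hf1 : 1 ≤ f L := hA.one_le_colors hf hn hL1
  have hs : 1 ≤ s := hA.one_le_space hf hn hL1 (by linarith)
  refine ⟨hL0, by linarith, ?_⟩
  have hK : 1 ≤ ⌊f L⌋₊ := (Nat.one_le_floor_iff _).2 hf1
  have hKf : (⌊f L⌋₊ : ℝ) ≤ f L := Nat.floor_le (by linarith)
  have hKn : 2 * ⌊f L⌋₊ ≤ n := by
    have : (2 : ℝ) * ⌊f L⌋₊ ≤ n := by linarith
    exact_mod_cast this
  have hmain := hA.space_ge hc₀ hn hf hL hL1 hK hKn (Nat.lt_floor_add_one _) hs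
  have hK' : (0 : ℝ) < ⌊f L⌋₊ := by exact_mod_cast hK
  rw [one_div, inv_mul_le_iff₀ (by positivity)]
  exact le_trans (by gcongr) hmain

lemma IsRobustColoring.mono {n s r L L' : ℕ} {f : ℕ → ℝ} {δ : ℝ}
    {A : StreamAlg (EdgeToken n) (Fin n → ℕ) s r} (hA : IsRobustColoring A L f δ) (h : L' ≤ L) :
    IsRobustColoring A L' f δ := by
  intro next
  refine (hA next).trans ?_
  unfold StreamAlg.coinProb
  gcongr
  exact Nat.card_le_card_of_injective
    (Subtype.map id fun R hR i h1 h2 hnd hΔ => hR i h1 h2 hnd (hΔ.trans h))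
    (Subtype.map_injective _ Function.injective_id)

end Asymptotics

theorem mainTheorem2 (c₀ : ℝ) (hc₀ : 0 < c₀) :
    -- the main bound: `S = Ω(n L² / f(L))`
    (∃ c : ℝ, 0 < c ∧ ∀ (n L s r : ℕ) (f : ℕ → ℝ) (A : StreamAlg (EdgeToken n) (Fin n → ℕ) s r),
      2 ≤ n → Monotone f → c₀ * Real.log n ≤ L → f L ≤ n / 2 → IsRobustColoring A L f (3 / 4) →
        c * (n * (L : ℝ) ^ 2 / f L) ≤ s) ∧
    -- `f(Δ) = Δ + 1` requires `S = Ω(n L)`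
    (∃ c : ℝ, 0 < c ∧ ∀ (n L s r : ℕ) (A : StreamAlg (EdgeToken n) (Fin n → ℕ) s r),
      2 ≤ n → c₀ * Real.log n ≤ L → (L : ℝ) + 1 ≤ n / 2 →
        IsRobustColoring A L (fun Δ => (Δ : ℝ) + 1) (3 / 4) →
        c * (n * L) ≤ s) ∧
    -- `f(Δ) = O(Δ)` requires `S = Ω(n L)`
    (∀ C : ℝ, 0 < C → ∃ c : ℝ, 0 < c ∧
      ∀ (n L s r : ℕ) (f : ℕ → ℝ) (A : StreamAlg (EdgeToken n) (Fin n → ℕ) s r),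
      2 ≤ n → Monotone f → c₀ * Real.log n ≤ L → f L ≤ n / 2 → IsRobustColoring A L f (3 / 4) →
        f L ≤ C * L → c * (n * L) ≤ s) ∧
    -- space `S = O(n polylog n)` requires `f(Δ) = Ω(Δ² / polylog n)`
    (∀ (B : ℝ) (k : ℕ), 0 < B → ∃ c : ℝ, 0 < c ∧
      ∀ (n L s r : ℕ) (f : ℕ → ℝ) (A : StreamAlg (EdgeToken n) (Fin n → ℕ) s r),
      2 ≤ n → Monotone f → c₀ * Real.log n ≤ L → f L ≤ n / 2 → IsRobustColoring A L f (3 / 4) →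
        (s : ℝ) ≤ B * (n * Real.log n ^ k) →
        ∀ Δ : ℕ, c₀ * Real.log n ≤ Δ → Δ ≤ L → c * ((Δ : ℝ) ^ 2 / Real.log n ^ k) ≤ f Δ) ∧
    -- `f(L) = Θ(n)` requires `S = Ω(L²)`
    (∀ a : ℝ, 0 < a → ∃ c : ℝ, 0 < c ∧
      ∀ (n L s r : ℕ) (f : ℕ → ℝ) (A : StreamAlg (EdgeToken n) (Fin n → ℕ) s r),
      2 ≤ n → Monotone f → c₀ * Real.log n ≤ L → f L ≤ n / 2 → IsRobustColoring A L f (3 / 4) →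
        a * n ≤ f L → c * (L : ℝ) ^ 2 ≤ s) := by

  have hX : 0 < 1 / (768 * Real.exp (1 + 4 / c₀)) := by positivity
  set c₁ := 1 / (768 * Real.exp (1 + 4 / c₀))
  have hlinear : ∀ C : ℝ, 0 < C → ∀ (n L s r : ℕ) (f : ℕ → ℝ)
      (A : StreamAlg (EdgeToken n) (Fin n → ℕ) s r), 2 ≤ n → Monotone f → c₀ * Real.log n ≤ L →
      f L ≤ n / 2 → IsRobustColoring A L f (3 / 4) → f L ≤ C * L → c₁ / C * (n * L) ≤ s := by
    intro C hC n L s r f A hn hf hL hfL hA hCL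
    obtain ⟨hL0, hf0, h⟩ := hA.space_bound hc₀ hn hf hL hfL
    refine le_trans ?_ h
    calc c₁ / C * (n * L) = c₁ * (n * (L : ℝ) ^ 2 / (C * L)) := by field_simp
      _ ≤ c₁ * (n * (L : ℝ) ^ 2 / f L) := by gcongr
  refine ⟨⟨c₁, hX, ?_⟩, ⟨c₁ / 2, by positivity, ?_⟩, fun C hC => ⟨c₁ / C, by positivity, ?_⟩,
    fun B k hB => ⟨c₁ / B, by positivity, ?_⟩, fun a ha => ⟨c₁ * 2, by positivity, ?_⟩⟩
  · intro n L s r f A hn hf hL hfL hA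
    exact (hA.space_bound hc₀ hn hf hL hfL).2.2
  · intro n L s r A hn hL hfL hA
    have hmono : Monotone fun Δ : ℕ => (Δ : ℝ) + 1 := fun x y hxy => by
      have : (x : ℝ) ≤ y := by exact_mod_cast hxy
      simpa using this
    have hL0 := (hA.space_bound hc₀ hn hmono hL hfL).1
    have hL1 : (1 : ℝ) ≤ L := by exact_mod_cast hL0
    exact hlinear 2 two_pos n L s r _ A hn hmono hL hfL hA (by linarith)
  · exact hlinear C hC
  · intro n L s r f A hn hf hL hfL hA hs Δ hΔ hΔL
    -- An algorithm for degrees up to `L` is one for degrees up to `Δ`.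
    obtain ⟨hΔ0, hf0, h⟩ :=
      (hA.mono hΔL).space_bound hc₀ hn hf hΔ ((hf hΔL).trans hfL)
    have hn2 : (2 : ℝ) ≤ n := by exact_mod_cast hn
    have hlog : 0 < Real.log n := Real.log_pos (by linarith)
    have h1 := h.trans hs
    rw [mul_div_assoc', div_le_iff₀ hf0] at h1
    rw [div_mul_div_comm, div_le_iff₀ (by positivity)]
    refine le_of_mul_le_mul_left ?_ (show (0 : ℝ) < n by linarith)
    linarith
  · intro n L s r f A hn hf hL hfL hA haf
    obtain ⟨hL0, hf0, h⟩ := hA.space_bound hc₀ hn hf hL hfL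
    have hn2 : (2 : ℝ) ≤ n := by exact_mod_cast hn
    refine le_trans ?_ h
    calc c₁ * 2 * (L : ℝ) ^ 2 = c₁ * (n * (L : ℝ) ^ 2 / (n / 2)) := by field_simp
      _ ≤ c₁ * (n * (L : ℝ) ^ 2 / f L) := by gcongr
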